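/- Let $(X,\mathcal B,\mu)$ be a probability space whose measure $\mu$ is separable (some countable family of measurable sets is dense in $\mathcal B$ for the distance $\mu(B\,\triangle\,C)$; equivalently $L^2(\mu)$ is separable), as is the case for a Borel probability measure on a compact metric space. Let $T:X\to X$ be measurable and $\mu$-preserving, and let $U_Tf=f\circ T$ on $L^2(\mu)$ (with real or complex scalars). A subsequence of $\mathbb N$ is a strictly increasing sequence $A=\{a_0<a_1<\cdots\}\subset\mathbb N$; a subsequence of $A$ is a sequence $S=\{a_{\varphi(0)}<a_{\varphi(1)}<\cdots\}$ with $\varphi:\mathbb N\to\mathbb N$ strictly increasing. The system $(X,\mathcal B,\mu,T)$ is called *rigid* if there is a strictly increasing sequence $(t_k)$ in $\mathbb N$ such that $U_T^{t_k}f\to f$ in $L^2(\mu)$ for every $f\in L^2(\mu)$. For $S=\{s_0<s_1<\cdots\}\subset\mathbb N$ the sequence entropy is $$h_\mu^S(T)=\sup_{\xi}\ \limsup_{n\to\infty}\frac1n H_\mu\Big(\bigvee_{i=0}^{n-1}T^{-s_i}\xi\Big),\qquad H_\mu(\eta)=-\sum_{C\in\eta}\mu(C)\log\mu(C)\quad(0\log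 0=0),$$ where the supremum is over all finite measurable partitions $\xi$ of $X$. **Theorem.** The following are equivalent: 1. $(X,\mathcal B,\mu,T)$ is rigid; 2. there is a subsequence $A$ of $\mathbb N$ such that $h_\mu^S(T)=0$ for every subsequence $S$ of $A$; 3. there is a subsequence $A$ of $\mathbb N$ such that $\{U_T^nf:n\in A\}$ is pre-compact (has compact closure) in $L^2(\mu)$ for every $f\in L^2(\mu)$. Moreover, for each individual subsequence $A$ of $\mathbb N$, one has $h_\mu^S(T)=0$ for every subsequence $S$ of $A$ if and only if $\{U_T^nf:n\in A\}$ is pre-compact in $L^2(\mu)$ for every $f\in L^2(\mu)$. -/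

import Mathlib

open MeasureTheory Filter Topology
open scoped ENNReal

noncomputable section

namespace SeqEntropy

variable {X : Type*} [MeasurableSpace X]

/-- A measurable partition of `X` with cells labelled by `ι` (finite when `ι` is). Some cells may
be empty; an empty cell contributes `0` to every entropy below. -/
structure MeasPartition (X : Type*) [MeasurableSpace X] (ι : Type*) where
  cell : ι → Set X
  measurableSet_cell : ∀ i, MeasurableSet (cell i)
  disjoint_cell : Pairwise (fun i j => Disjoint (cell i) (cell j))
  iUnion_cell : ⋃ i, cell i = Set.univ

/-- The pulled back partition `T⁻¹ ξ = {T⁻¹ A : A ∈ ξ}`. -/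
def MeasPartition.pullback {ι : Type*} (ξ : MeasPartition X ι) (T : X → X)
    (hT : Measurable T) : MeasPartition X ι where
  cell i := T ⁻¹' ξ.cell i
  measurableSet_cell i := hT (ξ.measurableSet_cell i)
  disjoint_cell _ _ hij := (ξ.disjoint_cell hij).preimage T
  iUnion_cell := by rw [← Set.preimage_iUnion, ξ.iUnion_cell, Set.preimage_univ]

/-- The common refinement `ξ 0 ∨ ⋯ ∨ ξ (n - 1)`, whose cells are the intersections
`A₀ ∩ ⋯ ∩ Aₙ₋₁` with `Aᵢ` a cell of `ξ i`. -/
def MeasPartition.join {ι : Type*} {n : ℕ} (ξ : Fin n → MeasPartition X ι) :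
    MeasPartition X (Fin n → ι) where
  cell a := ⋂ i, (ξ i).cell (a i)
  measurableSet_cell a := MeasurableSet.iInter fun i => (ξ i).measurableSet_cell (a i)
  disjoint_cell a b hab := by
    obtain ⟨i, hi⟩ := Function.ne_iff.mp hab
    exact ((ξ i).disjoint_cell hi).mono (Set.iInter_subset _ i) (Set.iInter_subset _ i)
  iUnion_cell := by
    refine Set.eq_univ_of_forall fun x => ?_
    have h : ∀ i, ∃ j, x ∈ (ξ i).cell j := fun i => by
      have hx : x ∈ ⋃ j, (ξ i).cell j := by rw [(ξ i).iUnion_cell]; exact Set.mem_univ x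
      exact Set.mem_iUnion.mp hx
    choose a ha using h
    exact Set.mem_iUnion.mpr ⟨a, Set.mem_iInter.mpr ha⟩

/-- The Shannon entropy `H_μ(ξ) = - ∑ μ(A) log μ(A)` over the cells `A` of `ξ`. -/
def partitionEntropy (μ : Measure X) {ι : Type*} [Fintype ι] (ξ : MeasPartition X ι) : ℝ :=
  - ∑ i, μ.real (ξ.cell i) * Real.log (μ.real (ξ.cell i))

/-- `h_μ^S(T, ξ) = limsup (1/n) H_μ(⋁ T^{-s} ξ)`, the join being over the first `n` terms
`s = S 0, …, S (n - 1)` of the sequence `S`. -/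
def seqEntropyPartition (μ : Measure X) {T : X → X} (hT : Measurable T) (S : ℕ → ℕ)
    {ι : Type*} [Fintype ι] (ξ : MeasPartition X ι) : EReal :=
  limsup (fun n : ℕ => (((1 / (n : ℝ)) * partitionEntropy μ
    (MeasPartition.join fun i : Fin n => ξ.pullback (T^[S i]) (hT.iterate (S i))) : ℝ) : EReal))
    atTop

/-- `h_μ^S(T)`, the supremum of `h_μ^S(T, ξ)` over all finite measurable partitions `ξ`. -/
def seqEntropy (μ : Measure X) {T : X → X} (hT : Measurable T) (S : ℕ → ℕ) : EReal :=
  ⨆ (k : ℕ) (ξ : MeasPartition X (Fin k)), seqEntropyPartition μ hT S ξ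

/-- The Koopman operator `U_T f = f ∘ T` on `L²(μ)`. -/
def koopman (𝕜 : Type*) [RCLike 𝕜] {μ : Measure X} {T : X → X} (hT : MeasurePreserving T μ μ) :
    Lp 𝕜 2 μ →ₗᵢ[𝕜] Lp 𝕜 2 μ :=
  Lp.compMeasurePreservingₗᵢ 𝕜 T hT

/-- Rigidity: `U_T^{t_k} f → f` in `L²(μ)` for all `f`, along one sequence `t_0 < t_1 < ⋯`
in `ℕ`. -/
def IsRigid (𝕜 : Type*) [RCLike 𝕜] {μ : Measure X} {T : X → X}
    (hT : MeasurePreserving T μ μ) : Prop :=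
  ∃ t : ℕ → ℕ, StrictMono t ∧
    ∀ f : Lp 𝕜 2 μ, Tendsto (fun k => (koopman 𝕜 hT)^[t k] f) atTop (𝓝 f)

/-- `h_μ^S(T) = 0` for every subsequence `S = A ∘ φ` of the sequence `A`. -/
def ZeroEntropyAlong {μ : Measure X} {T : X → X} (hT : MeasurePreserving T μ μ)
    (A : ℕ → ℕ) : Prop :=
  ∀ φ : ℕ → ℕ, StrictMono φ → seqEntropy μ hT.measurable (A ∘ φ) = 0

/-- `{U_T^n f : n ∈ A}` is pre-compact (has compact closure) in `L²(μ)` for every `f`. -/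
def PrecompactAlong (𝕜 : Type*) [RCLike 𝕜] {μ : Measure X} {T : X → X}
    (hT : MeasurePreserving T μ μ) (A : ℕ → ℕ) : Prop :=
  ∀ f : Lp 𝕜 2 μ, IsCompact (closure ((fun n : ℕ => (koopman 𝕜 hT)^[n] f) '' Set.range A))

end SeqEntropy

end

/-! Everything goes through precompactness. Since `U_T` is an isometry, precompactness of all orbits
along `A` need only be tested on indicators, where the `L²` distance is the square root of `μ(B ∆
D)`. Precompact implies zero entropy: up to a small error, each `T^{-s} ξ` with `s ∈ A` is one of
finitely many partitions. Their join `η` is fixed, so `n` pullbacks have joint entropy at most `H(η)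
+ nδ` (`labelEntropy_join_le`). Conversely, if the orbit of some set `B` along `A` is not totally
bounded, it always leaves the `ε`-neighbourhood of the finite algebra generated by its initial
terms. Choosing such terms greedily, each adds at least `ε` of entropy
(`exists_labelEntropy_add_le`), so that subsequence has positive entropy. Rigid implies precompact,
as a convergent sequence together with its limit is compact. Conversely, a diagonal subsequence is
Cauchy on a countable dense set, and differences of its terms are rigidity times. Only this last
step uses separability. -/

namespace SeqEntropy

open Real

/-! ### Inequalities for `-x log x` -/

section Numbers

lemma negMulLog_add_le {x y : ℝ} (hx : 0 ≤ x) (hy : 0 ≤ y) :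
    negMulLog (x + y) ≤ negMulLog x + negMulLog y := by
  rcases hx.eq_or_lt with rfl | hx
  · simp
  rcases hy.eq_or_lt with rfl | hy
  · simp
  have h1 := log_le_log hx (show x ≤ x + y by linarith)
  have h2 := log_le_log hy (show y ≤ x + y by linarith)
  simp only [negMulLog]
  nlinarith [mul_le_mul_of_nonneg_left h1 hx.le, mul_le_mul_of_nonneg_left h2 hy.le]

/-- Quantifies the entropy gained by splitting a cell: `log t ≤ t - 1` bounds the gain below by `2xy
/ (x + y)`, which is at least `min x y`. -/
lemma negMulLog_add_add_min_le {x y : ℝ} (hx : 0 ≤ x) (hy : 0 ≤ y) :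
    negMulLog (x + y) + min x y ≤ negMulLog x + negMulLog y := by
  rcases hx.eq_or_lt with rfl | hx
  · simp [hy]
  rcases hy.eq_or_lt with rfl | hy
  · simp [hx.le]
  have hs : 0 < x + y := by positivity
  have h1 := log_le_sub_one_of_pos (div_pos hx hs)
  have h2 := log_le_sub_one_of_pos (div_pos hy hs)
  rw [log_div hx.ne' hs.ne'] at h1
  rw [log_div hy.ne' hs.ne'] at h2
  have h3 : x * (x / (x + y) - 1) + y * (y / (x + y) - 1) = -(2 * (x * y) / (x + y)) := by
    field_simp; ring
  have h4 : min x y ≤ 2 * (x * y) / (x + y) := by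
    rw [le_div_iff₀ hs]
    rcases le_total x y with h | h
    · rw [min_eq_left h]; nlinarith
    · rw [min_eq_right h]; nlinarith
  simp only [negMulLog]
  nlinarith [mul_le_mul_of_nonneg_left h1 hx.le, mul_le_mul_of_nonneg_left h2 hy.le]

lemma negMulLog_sum_le {ι : Type*} (s : Finset ι) {p : ι → ℝ} (hp : ∀ i, 0 ≤ p i) :
    negMulLog (∑ i ∈ s, p i) ≤ ∑ i ∈ s, negMulLog (p i) := by
  classical
  induction s using Finset.induction_on with
  | empty => simp
  | insert a s ha ih =>
    rw [Finset.sum_insert ha, Finset.sum_insert ha]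
    exact (negMulLog_add_le (hp a) (Finset.sum_nonneg fun i _ => hp i)).trans (by gcongr)

/-- Subadditivity of entropy for a nonnegative matrix of arbitrary total mass. -/
lemma sum_negMulLog_add_le {ι κ : Type*} [Fintype ι] [Fintype κ] {q : ι → κ → ℝ}
    (hq : ∀ a c, 0 ≤ q a c) :
    (∑ a, ∑ c, negMulLog (q a c)) + negMulLog (∑ a, ∑ c, q a c) ≤
      (∑ a, negMulLog (∑ c, q a c)) + ∑ c, negMulLog (∑ a, q a c) := by
  set s := ∑ a, ∑ c, q a c with hs
  set r : ι → ℝ := fun a => ∑ c, q a c with hr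
  set k : κ → ℝ := fun c => ∑ a, q a c with hk
  have hks : ∑ c, k c = s := Finset.sum_comm
  -- This is `log t ≤ t - 1` at `t = r a * k c / (q a c * s)`. The corrections `r a * k c / s - q a
  -- c` sum to zero over all `a`, `c`.
  have key : ∀ a c, negMulLog (q a c) - q a c * log s ≤
      -(q a c * log (r a)) - q a c * log (k c) + (r a * k c / s - q a c) := by
    intro a c
    have hra : q a c ≤ r a := Finset.single_le_sum (fun c _ => hq a c) (Finset.mem_univ c)
    have hkc : q a c ≤ k c :=
      Finset.single_le_sum (f := fun a => q a c) (fun a _ => hq a c) (Finset.mem_univ a)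
    have hrs : r a ≤ s := Finset.single_le_sum (f := r)
      (fun a _ => Finset.sum_nonneg fun c _ => hq a c) (Finset.mem_univ a)
    rcases (hq a c).eq_or_lt with h | h
    · rw [← h]
      rw [← h] at hra hkc
      simpa using div_nonneg (mul_nonneg hra hkc) (hra.trans hrs)
    have hr0 := h.trans_le hra
    have hk0 := h.trans_le hkc
    have hs0 := hr0.trans_le hrs
    have hl := log_le_sub_one_of_pos (show 0 < r a * k c / (q a c * s) by positivity)
    rw [log_div (by positivity) (by positivity), log_mul hr0.ne' hk0.ne',
      log_mul h.ne' hs0.ne'] at hl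
    have h2 := mul_le_mul_of_nonneg_left hl h.le
    have h3 : q a c * (r a * k c / (q a c * s) - 1) = r a * k c / s - q a c := by
      field_simp
    simp only [negMulLog]
    linarith
  have hsum := Finset.sum_le_sum fun a (_ : a ∈ Finset.univ) =>
    Finset.sum_le_sum fun c (_ : c ∈ Finset.univ) => key a c
  have e0 : ∑ a, ∑ c, r a * k c / s = s := by
    simp_rw [← Finset.sum_div, ← Finset.mul_sum, hks, ← Finset.sum_mul]
    exact mul_self_div_self s
  have e1 : ∑ a, ∑ c, q a c * log s = s * log s := by
    simp_rw [← Finset.sum_mul]; rfl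
  have e2 : ∑ a, ∑ c, q a c * log (r a) = ∑ a, r a * log (r a) := by
    simp_rw [← Finset.sum_mul]; rfl
  have e3 : ∑ a, ∑ c, q a c * log (k c) = ∑ c, k c * log (k c) := by
    rw [Finset.sum_comm]; simp_rw [← Finset.sum_mul]; rfl
  simp only [Finset.sum_sub_distrib, Finset.sum_add_distrib, Finset.sum_neg_distrib, e0, e1, e2,
    e3] at hsum
  have e4 : ∑ a, negMulLog (r a) = -∑ a, r a * log (r a) := by simp [negMulLog]
  have e5 : ∑ c, negMulLog (k c) = -∑ c, k c * log (k c) := by simp [negMulLog]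
  have e6 : negMulLog s = -(s * log s) := by simp [negMulLog]
  rw [e4, e5, e6]
  linarith

end Numbers

/-! ### Entropy of finite-valued functions -/

section Labels

variable {X : Type*} [MeasurableSpace X] {μ : Measure X}
variable {ι κ ν : Type*} [Fintype ι] [Fintype κ] [Fintype ν]

/-- The Shannon entropy of the law of a finite-valued function. -/
noncomputable def labelEntropy (μ : Measure X) (f : X → ι) : ℝ :=
  ∑ i, negMulLog (μ.real (f ⁻¹' {i}))

lemma labelEntropy_equiv {f : X → ι} (e : ι ≃ κ) :
    labelEntropy μ (e ∘ f) = labelEntropy μ f := by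
  unfold labelEntropy
  rw [← e.sum_comp]
  congr! 4 with i
  ext x
  simp

lemma labelEntropy_prod (f : X → ι) (g : X → κ) :
    labelEntropy μ (fun x => (f x, g x)) =
      ∑ i, ∑ j, negMulLog (μ.real (f ⁻¹' {i} ∩ g ⁻¹' {j})) := by
  unfold labelEntropy
  rw [Fintype.sum_prod_type]
  congr! 5 with i _ j
  ext x
  simp

lemma labelEntropy_nonneg [IsProbabilityMeasure μ] (f : X → ι) : 0 ≤ labelEntropy μ f :=
  Finset.sum_nonneg fun _ _ => negMulLog_nonneg measureReal_nonneg measureReal_le_one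

variable [IsProbabilityMeasure μ] [MeasurableSpace ι] [MeasurableSpace κ] [MeasurableSpace ν]
  [DiscreteMeasurableSpace ι] [DiscreteMeasurableSpace κ] [DiscreteMeasurableSpace ν]

lemma measureReal_comp_preimage {κ : Type*} [DecidableEq κ] {f : X → ι} (hf : Measurable f)
    (g : ι → κ) (k : κ) :
    μ.real (g ∘ f ⁻¹' {k}) = ∑ i with g i = k, μ.real (f ⁻¹' {i}) := by
  rw [sum_measureReal_preimage_singleton _ fun i _ => hf (measurableSet_singleton i)]
  congr 1
  ext x
  simp

lemma labelEntropy_comp_le {κ : Type*} [Fintype κ] {f : X → ι} (hf : Measurable f) (g : ι → κ) :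
    labelEntropy μ (g ∘ f) ≤ labelEntropy μ f := by
  classical
  unfold labelEntropy
  simp_rw [measureReal_comp_preimage hf]
  rw [← Finset.sum_fiberwise (s := Finset.univ) (g := g)
    (f := fun i => negMulLog (μ.real (f ⁻¹' {i})))]
  exact Finset.sum_le_sum fun k _ => negMulLog_sum_le _ fun _ => measureReal_nonneg

lemma sum_measureReal_inter_preimage {g : X → κ} (hg : Measurable g) (s : Set X) :
    ∑ j, μ.real (s ∩ g ⁻¹' {j}) = μ.real s := by
  have h := sum_measureReal_preimage_singleton (μ := μ.restrict s) Finset.univ (f := g)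
    (fun y _ => hg (measurableSet_singleton y))
  simp only [measureReal_restrict_apply (hg (measurableSet_singleton _)), Finset.coe_univ,
    Set.preimage_univ, measureReal_restrict_apply MeasurableSet.univ, Set.univ_inter] at h
  rw [← h]
  simp_rw [Set.inter_comm]

/-- Strong subadditivity of entropy. -/
lemma labelEntropy_submodular {κ : Type*} [Fintype κ] (g : X → κ) {f : X → ι} {h : X → ν}
    (hf : Measurable f) (hh : Measurable h) :
    labelEntropy μ (fun x => (g x, f x, h x)) + labelEntropy μ g ≤
      labelEntropy μ (fun x => (g x, f x)) + labelEntropy μ (fun x => (g x, h x)) := by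
  have e1 : labelEntropy μ (fun x => (g x, f x, h x)) = ∑ b, ∑ a, ∑ c,
      negMulLog (μ.real (g ⁻¹' {b} ∩ f ⁻¹' {a} ∩ h ⁻¹' {c})) := by
    rw [labelEntropy_prod g fun x => (f x, h x)]
    simp_rw [Fintype.sum_prod_type, Set.inter_assoc]
    congr! 8 with b _ a _ c
    ext x
    simp
  rw [e1, labelEntropy_prod, labelEntropy_prod, labelEntropy, ← Finset.sum_add_distrib,
    ← Finset.sum_add_distrib]
  refine Finset.sum_le_sum fun b _ => ?_
  have := sum_negMulLog_add_le (q := fun a c => μ.real (g ⁻¹' {b} ∩ f ⁻¹' {a} ∩ h ⁻¹' {c}))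
    fun _ _ => measureReal_nonneg
  simp only [sum_measureReal_inter_preimage hh, sum_measureReal_inter_preimage hf] at this
  simp_rw [Set.inter_right_comm _ (f ⁻¹' _) (h ⁻¹' _),
    sum_measureReal_inter_preimage hf] at this
  simpa only [Set.inter_right_comm _ (h ⁻¹' _) (f ⁻¹' _)] using this

/-- Labels with nearly the same fibres have small relative entropy. -/
lemma exists_labelEntropy_prod_le (ι : Type*) [Fintype ι] [MeasurableSpace ι]
    [DiscreteMeasurableSpace ι] {δ : ℝ} (hδ : 0 < δ) :
    ∃ ε > 0, ∀ f g : X → ι, Measurable f → Measurable g →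
      (∀ i, μ.real (symmDiff (f ⁻¹' {i}) (g ⁻¹' {i})) < ε) →
      labelEntropy μ (fun x => (g x, f x)) ≤ labelEntropy μ g + δ := by
  classical
  -- Each entry of the joint law may err by `δ / N`; the `+ 1` keeps `N` positive when `ι` is empty.
  set N : ℝ := (Fintype.card ι : ℝ) * Fintype.card ι + 1 with hN
  have hN0 : 0 < N := by positivity
  have huc : UniformContinuousOn negMulLog (Set.Icc 0 1) :=
    isCompact_Icc.uniformContinuousOn_of_continuous continuous_negMulLog.continuousOn
  obtain ⟨ε, hε, H⟩ := Metric.uniformContinuousOn_iff.1 huc (δ / N) (by positivity)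
  refine ⟨ε, hε, fun f g hf hg hfg => ?_⟩
  have key : ∀ i j, negMulLog (μ.real (g ⁻¹' {i} ∩ f ⁻¹' {j})) ≤
      (if i = j then negMulLog (μ.real (g ⁻¹' {i})) else 0) + δ / N := by
    intro i j
    have hI : ∀ s : Set X, μ.real s ∈ Set.Icc (0 : ℝ) 1 :=
      fun s => ⟨measureReal_nonneg, measureReal_le_one⟩
    split_ifs with hij
    · subst hij
      have hd : |μ.real (g ⁻¹' {i} ∩ f ⁻¹' {i}) - μ.real (g ⁻¹' {i})| < ε := by
        have h1 : μ.real (g ⁻¹' {i} ∩ f ⁻¹' {i}) + μ.real (g ⁻¹' {i} \ f ⁻¹' {i}) =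
          μ.real (g ⁻¹' {i}) := measureReal_inter_add_sdiff (hf (measurableSet_singleton i))
        have h2 : μ.real (g ⁻¹' {i} \ f ⁻¹' {i}) ≤
            μ.real (symmDiff (f ⁻¹' {i}) (g ⁻¹' {i})) :=
          measureReal_mono Set.subset_union_right
        have h3 := hfg i
        have h4 : 0 ≤ μ.real (g ⁻¹' {i} \ f ⁻¹' {i}) := measureReal_nonneg
        rw [abs_lt]; constructor <;> linarith
      have := H _ (hI _) _ (hI _) hd
      rw [Real.dist_eq] at this
      linarith [(abs_lt.1 this).2]
    · have hd : |μ.real (g ⁻¹' {i} ∩ f ⁻¹' {j}) - 0| < ε := by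
        rw [sub_zero, abs_of_nonneg measureReal_nonneg]
        refine (measureReal_mono ?_).trans_lt (hfg i)
        rintro x ⟨hx, hx'⟩
        refine Or.inr ⟨hx, fun hx'' => hij ?_⟩
        simp only [Set.mem_preimage, Set.mem_singleton_iff] at hx' hx''
        exact hx''.symm.trans hx'
      have := H _ (hI _) 0 (by simp) hd
      rw [Real.dist_eq, negMulLog_zero, sub_zero] at this
      linarith [(abs_lt.1 this).2]
  rw [labelEntropy_prod]
  calc _ ≤ ∑ i, ∑ j, ((if i = j then negMulLog (μ.real (g ⁻¹' {i})) else 0) + δ / N) :=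
        Finset.sum_le_sum fun i _ => Finset.sum_le_sum fun j _ => key i j
    _ = labelEntropy μ g + (N - 1) * (δ / N) := by
        simp [Finset.sum_add_distrib, labelEntropy, hN]; ring
    _ ≤ labelEntropy μ g + δ := by
        have : N * (δ / N) = δ := by field_simp
        have : 0 ≤ δ / N := by positivity
        linarith

/-- Entropy gained from a two-valued label is at least its distance to the first label. -/
lemma exists_labelEntropy_add_le {ι : Type*} [Fintype ι] (f : X → ι) {g : X → Fin 2}
    (hg : Measurable g) :
    ∃ M : Set ι, labelEntropy μ f + μ.real (symmDiff (g ⁻¹' {0}) (f ⁻¹' M)) ≤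
      labelEntropy μ (fun x => (f x, g x)) := by
  classical
  let p : ι → Fin 2 → ℝ := fun i j => μ.real (f ⁻¹' {i} ∩ g ⁻¹' {j})
  -- Majority vote on each fibre of `f`: the symmetric difference then meets it only in its smaller
  -- piece, of mass `min (p i 0) (p i 1)`.
  refine ⟨{i | p i 1 ≤ p i 0}, ?_⟩
  have hsub : symmDiff (g ⁻¹' {0}) (f ⁻¹' {i | p i 1 ≤ p i 0}) ⊆
      ⋃ i ∈ (Finset.univ : Finset ι), f ⁻¹' {i} ∩ g ⁻¹' {if p i 1 ≤ p i 0 then 1 else 0} := by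
    intro x hx
    simp only [Finset.mem_univ, Set.iUnion_true, Set.mem_iUnion]
    refine ⟨f x, rfl, ?_⟩
    rcases hx with ⟨h1, h2⟩ | ⟨h1, h2⟩
    · simp only [Set.mem_preimage, Set.mem_ofPred_eq] at h2
      simpa [h2] using h1
    · simp only [Set.mem_preimage, Set.mem_ofPred_eq, Set.mem_singleton_iff] at h1 h2
      simp only [h1, if_true, Set.mem_preimage, Set.mem_singleton_iff]
      omega
  have hle : μ.real (symmDiff (g ⁻¹' {0}) (f ⁻¹' {i | p i 1 ≤ p i 0})) ≤
      ∑ i, min (p i 0) (p i 1) := by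
    refine (measureReal_mono hsub (measure_ne_top _ _)).trans
      ((measureReal_biUnion_finset_le _ _).trans ?_)
    refine Finset.sum_le_sum fun i _ => ?_
    split_ifs with h
    · rw [min_eq_right h]
    · rw [min_eq_left (not_le.1 h).le]
  rw [labelEntropy_prod, labelEntropy]
  refine (add_le_add_right hle _).trans ?_
  rw [← Finset.sum_add_distrib]
  refine Finset.sum_le_sum fun i _ => ?_
  rw [← sum_measureReal_inter_preimage hg (f ⁻¹' {i}), Fin.sum_univ_two, Fin.sum_univ_two]
  exact negMulLog_add_add_min_le measureReal_nonneg measureReal_nonneg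

end Labels

/-! ### Entropy growth of joins -/

section Joins

variable {X : Type*} [MeasurableSpace X] {μ : Measure X}

lemma labelEntropy_fin_succ {ι : Type*} [Fintype ι] (g : ℕ → X → ι) (n : ℕ) :
    labelEntropy μ (fun x (i : Fin (n + 1)) => g i x) =
      labelEntropy μ (fun x => ((fun i : Fin n => g i x), g n x)) := by
  rw [← labelEntropy_equiv (f := fun x => ((fun i : Fin n => g i x), g n x))
    ((Equiv.prodComm _ _).trans (Fin.snocEquiv fun _ : Fin (n + 1) => ι))]
  congr 1
  funext x i
  refine Fin.lastCases ?_ (fun j => ?_) i <;> simp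

variable [IsProbabilityMeasure μ]

/-- If every `g i` has relative entropy at most `δ` over some coarsening of the fixed finite
label `η`, then the join of the first `n` labels has entropy at most `H(η) + n δ`. -/
lemma labelEntropy_join_le {ι κ : Type*} [Fintype ι] [MeasurableSpace ι]
    [DiscreteMeasurableSpace ι] [Fintype κ] [MeasurableSpace κ] [DiscreteMeasurableSpace κ]
    {η : X → κ} (hη : Measurable η) {g : ℕ → X → ι} (hg : ∀ i, Measurable (g i)) {δ : ℝ}
    (h : ∀ i, ∃ k : κ → ι, labelEntropy μ (fun x => (k (η x), g i x)) ≤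
      labelEntropy μ (fun x => k (η x)) + δ) (n : ℕ) :
    labelEntropy μ (fun x (i : Fin n) => g i x) ≤ labelEntropy μ η + n * δ := by
  have hjoin : ∀ n, Measurable fun x (i : Fin n) => g i x :=
    fun n => measurable_pi_lambda _ fun i => hg i
  -- Conditioning on `η` rather than on its coarsening `k ∘ η` cannot increase relative entropy.
  have hstep : ∀ i, labelEntropy μ (fun x => (η x, g i x)) ≤ labelEntropy μ η + δ := by
    intro i
    obtain ⟨k, hk⟩ := h i
    have h1 := labelEntropy_submodular (μ := μ) (fun x => k (η x)) hη (hg i)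
    have h2 : labelEntropy μ (fun x => (η x, g i x)) ≤
        labelEntropy μ (fun x => (k (η x), η x, g i x)) :=
      labelEntropy_comp_le (f := fun x => (k (η x), η x, g i x))
        (((measurable_of_finite k).comp hη).prodMk (hη.prodMk (hg i))) Prod.snd
    have h3 : labelEntropy μ (fun x => (k (η x), η x)) ≤ labelEntropy μ η :=
      labelEntropy_comp_le hη fun a => (k a, a)
    linarith
  have hmain : ∀ n : ℕ, labelEntropy μ (fun x => (η x, fun i : Fin n => g i x)) ≤
      labelEntropy μ η + n * δ := by
    intro n
    induction n with
    | zero =>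
      have := labelEntropy_comp_le (μ := μ) hη fun a => (a, fun i : Fin 0 => (i.elim0 : ι))
      simp only [Nat.cast_zero, zero_mul, add_zero]
      convert this using 3 with x
      simp [Subsingleton.elim (α := Fin 0 → ι) _ fun i => i.elim0]
    | succ n ih =>
      have h1 := labelEntropy_submodular (μ := μ) η (hjoin n) (hg n)
      have h2 := hstep n
      have h3 : labelEntropy μ (fun x => (η x, fun i : Fin (n + 1) => g i x)) ≤
          labelEntropy μ (fun x => (η x, (fun i : Fin n => g i x), g n x)) := by
        have := labelEntropy_comp_le (μ := μ) (hη.prodMk ((hjoin n).prodMk (hg n)))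
          fun a => (a.1, Fin.snocEquiv (fun _ : Fin (n + 1) => ι) (a.2.2, a.2.1))
        convert this using 3 with x
        ext i
        · rfl
        · refine Fin.lastCases ?_ (fun j => ?_) i <;> simp
      push_cast
      linarith
  exact (labelEntropy_comp_le (hη.prodMk (hjoin n)) Prod.snd).trans (hmain n)

end Joins

/-! ### From partitions to labels -/

section Partitions

variable {X : Type*} [MeasurableSpace X]

/-- With labels in place of cells, joins become tuples and coarsenings become compositions. -/
lemma MeasPartition.exists_label {ι : Type*} (ξ : MeasPartition X ι) :
    ∃ f : X → ι, ∀ i, f ⁻¹' {i} = ξ.cell i := by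
  have h : ∀ x, ∃ i, x ∈ ξ.cell i := fun x => by
    have hx : x ∈ ⋃ i, ξ.cell i := by rw [ξ.iUnion_cell]; exact Set.mem_univ x
    exact Set.mem_iUnion.mp hx
  choose f hf using h
  refine ⟨f, fun i => Set.ext fun x => ⟨?_, fun hx => ?_⟩⟩
  · rintro rfl
    exact hf x
  · by_contra hne
    exact Set.disjoint_left.1 (ξ.disjoint_cell hne) (hf x) hx

/-- The partition of `X` into the fibres of a measurable function. -/
def MeasPartition.ofLabel {ι : Type*} [MeasurableSpace ι] [MeasurableSingletonClass ι]
    {f : X → ι} (hf : Measurable f) : MeasPartition X ι where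
  cell i := f ⁻¹' {i}
  measurableSet_cell i := hf (measurableSet_singleton i)
  disjoint_cell _ _ hij := (Set.disjoint_singleton.2 hij).preimage f
  iUnion_cell := by rw [← Set.preimage_iUnion, Set.iUnion_of_singleton, Set.preimage_univ]

lemma partitionEntropy_join {μ : Measure X} {T : X → X} (hT : Measurable T) (S : ℕ → ℕ)
    {ι : Type*} [Fintype ι] {ξ : MeasPartition X ι} {f : X → ι} (hf : ∀ i, f ⁻¹' {i} = ξ.cell i)
    (n : ℕ) :
    partitionEntropy μ (MeasPartition.join fun i : Fin n =>
      ξ.pullback (T^[S i]) (hT.iterate (S i))) =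
      labelEntropy μ (fun x (i : Fin n) => f (T^[S i] x)) := by
  unfold partitionEntropy labelEntropy
  rw [← Finset.sum_neg_distrib]
  refine Finset.sum_congr rfl fun a _ => ?_
  have : (MeasPartition.join fun i : Fin n => ξ.pullback (T^[S i]) (hT.iterate (S i))).cell a =
      (fun x (i : Fin n) => f (T^[S i] x)) ⁻¹' {a} := by
    ext x
    simp [MeasPartition.join, MeasPartition.pullback, ← hf, funext_iff]
  rw [this, Real.negMulLog, neg_mul]

lemma seqEntropyPartition_nonneg (μ : Measure X) [IsProbabilityMeasure μ] {T : X → X}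
    (hT : Measurable T) (S : ℕ → ℕ) {ι : Type*} [Fintype ι] (ξ : MeasPartition X ι) :
    0 ≤ seqEntropyPartition μ hT S ξ := by
  obtain ⟨f, hf⟩ := ξ.exists_label
  refine le_limsup_of_frequently_le (Eventually.of_forall fun n => ?_).frequently
  rw [partitionEntropy_join hT S hf]
  exact EReal.coe_nonneg.2 (mul_nonneg (by positivity) (labelEntropy_nonneg _))

lemma seqEntropy_eq_zero_iff (μ : Measure X) [IsProbabilityMeasure μ] {T : X → X}
    (hT : Measurable T) (S : ℕ → ℕ) :
    seqEntropy μ hT S = 0 ↔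
      ∀ (k : ℕ) (ξ : MeasPartition X (Fin k)), seqEntropyPartition μ hT S ξ ≤ 0 := by
  rw [← iSup₂_le_iff]
  refine ⟨fun h => h.le, fun h => le_antisymm h ?_⟩
  refine (seqEntropyPartition_nonneg μ hT S
    (MeasPartition.ofLabel (f := fun _ => (0 : Fin 1)) measurable_const)).trans ?_
  exact le_iSup₂ (f := fun k (ξ : MeasPartition X (Fin k)) => seqEntropyPartition μ hT S ξ) 1 _

lemma seqEntropyPartition_le {μ : Measure X} {T : X → X} (hT : Measurable T) (S : ℕ → ℕ)
    {ι : Type*} [Fintype ι] (ξ : MeasPartition X ι) {f : X → ι} (hf : ∀ i, f ⁻¹' {i} = ξ.cell i)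
    {C δ : ℝ} (h : ∀ n : ℕ, labelEntropy μ (fun x (i : Fin n) => f (T^[S i] x)) ≤ C + n * δ) :
    seqEntropyPartition μ hT S ξ ≤ δ := by
  have hlim : Tendsto (fun n : ℕ => ((C * (1 / (n : ℝ)) + δ : ℝ) : EReal)) atTop
      (𝓝 (δ : EReal)) := by
    refine (continuous_coe_real_ereal.tendsto δ).comp ?_
    simpa using (tendsto_one_div_atTop_nhds_zero_nat.const_mul C).add_const δ
  rw [← hlim.limsup_eq]
  refine limsup_le_limsup ?_
  filter_upwards [eventually_gt_atTop 0] with n hn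
  rw [partitionEntropy_join hT S hf]
  have hn' : (0 : ℝ) < n := by exact_mod_cast hn
  refine EReal.coe_le_coe_iff.2 ((mul_le_mul_of_nonneg_left (h n) (by positivity)).trans_eq ?_)
  field_simp

lemma le_seqEntropyPartition {μ : Measure X} {T : X → X} (hT : Measurable T) (S : ℕ → ℕ)
    {ι : Type*} [Fintype ι] (ξ : MeasPartition X ι) {f : X → ι} (hf : ∀ i, f ⁻¹' {i} = ξ.cell i)
    {δ : ℝ} (h : ∀ n : ℕ, n * δ ≤ labelEntropy μ (fun x (i : Fin n) => f (T^[S i] x))) :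
    δ ≤ seqEntropyPartition μ hT S ξ := by
  refine le_limsup_of_frequently_le (Eventually.frequently ?_)
  filter_upwards [eventually_gt_atTop 0] with n hn
  rw [partitionEntropy_join hT S hf]
  have hn' : (0 : ℝ) < n := by exact_mod_cast hn
  refine EReal.coe_le_coe_iff.2 (le_trans (le_of_eq ?_)
    (mul_le_mul_of_nonneg_left (h n) (show 0 ≤ 1 / (n : ℝ) by positivity)))
  field_simp

end Partitions

/-! ### Koopman orbits and symmetric differences -/

section Koopman

variable {𝕜 : Type*} [RCLike 𝕜] {X : Type*} [MeasurableSpace X] {μ : Measure X}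
  {T : X → X}

lemma koopman_iterate_dist (hT : MeasurePreserving T μ μ) (n : ℕ) (f g : Lp 𝕜 2 μ) :
    dist ((koopman 𝕜 hT)^[n] f) ((koopman 𝕜 hT)^[n] g) = dist f g := by
  rw [← LinearIsometry.coe_pow, LinearIsometry.dist_map]

variable [IsProbabilityMeasure μ]

lemma koopman_iterate_indicatorConstLp (hT : MeasurePreserving T μ μ) {B : Set X}
    (hB : MeasurableSet B) (c : 𝕜) (n : ℕ) :
    (koopman 𝕜 hT)^[n] (indicatorConstLp 2 hB (measure_ne_top μ B) c) =
      indicatorConstLp 2 (hT.measurable.iterate n hB) (measure_ne_top μ _) c := by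
  induction n with
  | zero => rfl
  | succ n ih =>
    rw [Function.iterate_succ_apply', ih]
    refine (Lp.indicatorConstLp_compMeasurePreserving (hT.measurable.iterate n hB)
      (measure_ne_top μ _) c hT).trans ?_
    simp_rw [Function.iterate_succ]

lemma dist_indicatorConstLp_two {B D : Set X} (hB : MeasurableSet B) (hD : MeasurableSet D)
    (c : 𝕜) :
    dist (indicatorConstLp 2 hB (measure_ne_top μ B) c)
      (indicatorConstLp 2 hD (measure_ne_top μ D) c) =
      ‖c‖ * √(μ.real (symmDiff B D)) := by
  rw [dist_indicatorConstLp_eq_norm, norm_indicatorConstLp (by simp) (by simp),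
    Real.sqrt_eq_rpow]
  simp

/-- Along a precompact sequence, finitely many iterates approximate all the others,
simultaneously on the members of a finite family of sets. -/
lemma PrecompactAlong.exists_finset {hT : MeasurePreserving T μ μ} {A : ℕ → ℕ}
    (h : PrecompactAlong 𝕜 hT A) {ι : Type*} [Fintype ι] {B : ι → Set X}
    (hB : ∀ i, MeasurableSet (B i)) {ε : ℝ} (hε : 0 < ε) :
    ∃ F : Finset ℕ, ∀ n, ∃ m ∈ F, ∀ i,
      μ.real (symmDiff (T^[A n] ⁻¹' B i) (T^[m] ⁻¹' B i)) < ε := by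
  classical
  let v : ℕ → ι → Lp 𝕜 2 μ := fun n i =>
    (koopman 𝕜 hT)^[n] (indicatorConstLp 2 (hB i) (measure_ne_top μ _) 1)
  -- Working in the product of the orbit closures makes one `m` serve every `i` at once.
  have hK : TotallyBounded (v '' Set.range A) := by
    refine (isCompact_univ_pi fun i =>
      h (indicatorConstLp 2 (hB i) (measure_ne_top μ _) 1)).totallyBounded.subset ?_
    rintro _ ⟨n, hn, rfl⟩ i -
    exact subset_closure ⟨n, hn, rfl⟩
  obtain ⟨t, hts, htf, ht⟩ := Metric.finite_approx_of_totallyBounded hK (√ε) (by positivity)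
  have hts' : ∀ y ∈ t, ∃ m, v m = y := fun y hy => by
    obtain ⟨m, -, hm⟩ := hts hy
    exact ⟨m, hm⟩
  choose! m hm using hts'
  refine ⟨htf.toFinset.image m, fun n => ?_⟩
  obtain ⟨y, hy, hyn⟩ := Set.mem_iUnion₂.1 (ht ⟨A n, ⟨n, rfl⟩, rfl⟩)
  refine ⟨m y, Finset.mem_image_of_mem _ (htf.mem_toFinset.2 hy), fun i => ?_⟩
  have hd := (dist_le_pi_dist (v (A n)) y i).trans_lt hyn
  rw [← hm y hy] at hd
  simp only [v, koopman_iterate_indicatorConstLp, dist_indicatorConstLp_two, norm_one,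
    one_mul] at hd
  exact (Real.sqrt_lt_sqrt_iff measureReal_nonneg).1 hd

/-- The functions with precompact orbit are closed under sums and, `U_T` being isometric, under
limits, so indicators suffice. The approximating sets need not lie in the orbit. -/
lemma precompactAlong_of_sets (hT : MeasurePreserving T μ μ) (A : ℕ → ℕ)
    (h : ∀ B : Set X, MeasurableSet B → ∀ ε > 0, ∃ F : Set (Set X), F.Finite ∧
      (∀ D ∈ F, MeasurableSet D) ∧ ∀ n, ∃ D ∈ F, μ.real (symmDiff (T^[A n] ⁻¹' B) D) < ε) :
    PrecompactAlong 𝕜 hT A := by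
  classical
  intro f
  induction f using Lp.induction (p := 2) ENNReal.ofNat_ne_top with
  | indicatorConst c hs hμs =>
    rename_i B
    rw [Lp.simpleFunc.coe_indicatorConst]
    refine TotallyBounded.isCompact_of_isClosed (TotallyBounded.closure ?_) isClosed_closure
    refine Metric.totallyBounded_iff.2 fun ε hε => ?_
    -- Squared because the distance is `‖c‖ √μ(B ∆ D)`; the `+ 1` allows `c = 0`.
    obtain ⟨F, hF, hFm, hFA⟩ := h B hs ((ε / (‖c‖ + 1)) ^ 2) (by positivity)
    let e : Set X → Lp 𝕜 2 μ := fun D =>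
      if hD : MeasurableSet D then indicatorConstLp 2 hD (measure_ne_top μ _) c else 0
    refine ⟨e '' F, hF.image e, ?_⟩
    rintro _ ⟨_, ⟨n, rfl⟩, rfl⟩
    obtain ⟨D, hD, hlt⟩ := hFA n
    refine Set.mem_iUnion₂.2 ⟨e D, ⟨D, hD, rfl⟩, ?_⟩
    simp only [e, dif_pos (hFm D hD), Metric.mem_ball, koopman_iterate_indicatorConstLp,
      dist_indicatorConstLp_two]
    have h1 : √(μ.real (symmDiff (T^[A n] ⁻¹' B) D)) < ε / (‖c‖ + 1) :=
      (Real.sqrt_lt' (by positivity)).2 hlt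
    calc _ ≤ (‖c‖ + 1) * √(μ.real (symmDiff (T^[A n] ⁻¹' B) D)) := by gcongr; linarith
      _ < (‖c‖ + 1) * (ε / (‖c‖ + 1)) := by gcongr
      _ = ε := by field_simp
  | add hf hg _ ihf ihg =>
    refine (ihf.add ihg).of_isClosed_subset isClosed_closure
      (closure_minimal ?_ (ihf.add ihg).isClosed)
    rintro _ ⟨n, hn, rfl⟩
    refine Set.mem_add.2 ⟨_, subset_closure ⟨n, hn, rfl⟩, _, subset_closure ⟨n, hn, rfl⟩, ?_⟩
    exact (iterate_map_add (koopman 𝕜 hT) n _ _).symm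
  | isClosed =>
    refine isClosed_of_closure_subset fun f hf => ?_
    refine TotallyBounded.isCompact_of_isClosed (TotallyBounded.closure ?_) isClosed_closure
    refine Metric.totallyBounded_iff.2 fun ε hε => ?_
    obtain ⟨g, hg, hfg⟩ := Metric.mem_closure_iff.1 hf (ε / 2) (by positivity)
    obtain ⟨t, htf, ht⟩ := Metric.totallyBounded_iff.1
      (IsCompact.totallyBounded hg) (ε / 2) (by positivity)
    refine ⟨t, htf, ?_⟩
    rintro _ ⟨n, hn, rfl⟩
    obtain ⟨y, hy, hyn⟩ := Set.mem_iUnion₂.1 (ht (subset_closure ⟨n, hn, rfl⟩))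
    refine Set.mem_iUnion₂.2 ⟨y, hy, ?_⟩
    have h1 := koopman_iterate_dist hT n f g
    have h2 := dist_triangle ((koopman 𝕜 hT)^[n] f) ((koopman 𝕜 hT)^[n] g) y
    rw [Metric.mem_ball] at hyn ⊢
    simp only at hyn ⊢
    linarith

end Koopman

/-! ### Rigidity, precompactness and zero entropy -/

section Equivalence

variable {𝕜 : Type*} [RCLike 𝕜] {X : Type*} [MeasurableSpace X] {μ : Measure X}
  {T : X → X} {hT : MeasurePreserving T μ μ} {A : ℕ → ℕ}

lemma IsRigid.exists_precompactAlong (h : IsRigid 𝕜 hT) :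
    ∃ A : ℕ → ℕ, StrictMono A ∧ PrecompactAlong 𝕜 hT A := by
  obtain ⟨t, ht, hlim⟩ := h
  refine ⟨t, ht, fun f => ?_⟩
  have hK := (hlim f).isCompact_insert_range
  refine hK.of_isClosed_subset isClosed_closure (closure_minimal ?_ hK.isClosed)
  rintro _ ⟨_, ⟨n, rfl⟩, rfl⟩
  exact Or.inr ⟨n, rfl⟩

/-- If `U^a e` and `U^b e` are close with `a < b`, cancelling the isometry `U^a` shows that `U^(b -
a) e` is close to `e`; no invertibility is needed. -/
lemma PrecompactAlong.isRigid [IsSeparable μ] (hA : StrictMono A) (h : PrecompactAlong 𝕜 hT A) :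
    IsRigid 𝕜 hT := by
  have : Fact ((2 : ℝ≥0∞) ≠ ∞) := ⟨ENNReal.ofNat_ne_top⟩
  let U := koopman 𝕜 hT
  let e : ℕ → Lp 𝕜 2 μ := TopologicalSpace.denseSeq (Lp 𝕜 2 μ)
  obtain ⟨a, -, φ, hφ, hlim⟩ := (isCompact_univ_pi fun i => h (e i)).tendsto_subseq
    (x := fun n i => U^[A n] (e i)) fun n i _ => subset_closure ⟨A n, ⟨n, rfl⟩, rfl⟩
  have hcauchy : ∀ i, CauchySeq fun n => U^[A (φ n)] (e i) :=
    fun i => (tendsto_pi_nhds.1 hlim i).cauchySeq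
  have hAφ : StrictMono (A ∘ φ) := hA.comp hφ
  have hfreq : ∀ n : ℕ, ∃ᶠ t in atTop, ∀ i ∈ Finset.range n,
      dist (U^[t] (e i)) (e i) < 1 / (n + 1 : ℝ) := by
    intro n
    refine frequently_atTop.2 fun N => ?_
    have hev : ∀ᶠ K in atTop, ∀ i ∈ Finset.range n, ∀ k ≥ K,
        dist (U^[A (φ k)] (e i)) (U^[A (φ K)] (e i)) < 1 / (n + 1 : ℝ) := by
      refine (Finset.eventually_all _).2 fun i _ => ?_
      obtain ⟨K, hK⟩ := Metric.cauchySeq_iff.1 (hcauchy i) (1 / (n + 1 : ℝ)) (by positivity)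
      filter_upwards [eventually_ge_atTop K] with L hL k hk
      exact hK k (hL.trans hk) L hL
    obtain ⟨K, hK⟩ := hev.exists
    -- The gap `N` makes the return times unbounded, so a strictly increasing sequence can be
    -- extracted.
    obtain ⟨k, hk, hkK⟩ := ((hAφ.tendsto_atTop.eventually_ge_atTop (A (φ K) + N)).and
      (eventually_ge_atTop K)).exists
    simp only [Function.comp_apply] at hk
    refine ⟨A (φ k) - A (φ K), by omega, fun i hi => ?_⟩
    have := hK i hi k hkK
    rwa [show A (φ k) = A (φ K) + (A (φ k) - A (φ K)) by omega, Function.iterate_add_apply,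
      koopman_iterate_dist] at this
  obtain ⟨t, ht, htU⟩ := extraction_forall_of_frequently hfreq
  refine ⟨t, ht, fun f => Metric.tendsto_atTop.2 fun ε hε => ?_⟩
  obtain ⟨i, hi⟩ := (TopologicalSpace.denseRange_denseSeq (Lp 𝕜 2 μ)).exists_dist_lt f
    (show 0 < ε / 3 by positivity)
  obtain ⟨N, hN⟩ := exists_nat_one_div_lt (show 0 < ε / 3 by positivity)
  refine ⟨max N (i + 1), fun n hn => ?_⟩
  have h1 := htU n i (Finset.mem_range.2 (by omega))
  have h2 : 1 / (n + 1 : ℝ) ≤ 1 / (N + 1 : ℝ) := by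
    have : (N : ℝ) ≤ n := by exact_mod_cast (le_max_left _ _).trans hn
    gcongr
  have h3 := koopman_iterate_dist hT (t n) f (e i)
  have h4 := dist_triangle4 (U^[t n] f) (U^[t n] (e i)) (e i) f
  rw [dist_comm (e i) f] at h4
  change dist f (e i) < ε / 3 at hi
  change dist (U^[t n] f) (U^[t n] (e i)) = _ at h3
  change dist (U^[t n] f) f < ε
  linarith

variable [IsProbabilityMeasure μ]

lemma PrecompactAlong.zeroEntropyAlong (h : PrecompactAlong 𝕜 hT A) : ZeroEntropyAlong hT A := by
  intro φ _
  refine (seqEntropy_eq_zero_iff μ hT.measurable _).2 fun k ξ => ?_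
  obtain ⟨f, hf⟩ := ξ.exists_label
  have hfm : Measurable f := measurable_to_countable' fun i => by
    rw [hf]; exact ξ.measurableSet_cell i
  refine EReal.le_of_forall_lt_iff_le.1 fun δ hδ => ?_
  have hδ' : 0 < δ := by exact_mod_cast hδ
  obtain ⟨ε, hε, H⟩ := exists_labelEntropy_prod_le (X := X) (μ := μ) (Fin k) hδ'
  obtain ⟨F, hF⟩ := h.exists_finset (fun i => hfm (measurableSet_singleton i)) hε
  have hTm := fun n => hfm.comp (hT.measurable.iterate n)
  refine seqEntropyPartition_le _ _ ξ hf (labelEntropy_join_le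
    (η := fun x (j : F) => f (T^[j] x)) (measurable_pi_lambda _ fun j => hTm j)
    (g := fun i x => f (T^[(A ∘ φ) i] x)) (fun i => hTm _) fun i => ?_)
  obtain ⟨m, hm, hmi⟩ := hF (φ i)
  exact ⟨fun a => a ⟨m, hm⟩, H _ _ (hTm _) (hTm m) hmi⟩

lemma ZeroEntropyAlong.precompactAlong (h : ZeroEntropyAlong hT A) : PrecompactAlong 𝕜 hT A := by
  classical
  refine precompactAlong_of_sets hT A fun B hB ε hε => ?_
  by_contra! hcon
  let f : X → Fin 2 := fun x => if x ∈ B then 0 else 1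
  have hfm : Measurable f := Measurable.ite hB measurable_const measurable_const
  have hf0 : f ⁻¹' {0} = B := by ext x; by_cases hx : x ∈ B <;> simp [f, hx]
  let g : ℕ → X → Fin 2 := fun n x => f (T^[A n] x)
  have hgm : ∀ n, Measurable (g n) := fun n => hfm.comp (hT.measurable.iterate _)
  have hg0 : ∀ n, g n ⁻¹' {0} = T^[A n] ⁻¹' B := fun n => by rw [← hf0]; rfl
  -- each `N` has a later term that is `ε`-far from the algebra generated by the first ones
  have hnext : ∀ N : ℕ, ∃ y > N, ∀ G : Set (Fin (N + 1) → Fin 2),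
      ε ≤ μ.real (symmDiff (g y ⁻¹' {0}) ((fun x (i : Fin (N + 1)) => g i x) ⁻¹' G)) := by
    intro N
    obtain ⟨y, hy⟩ := hcon
      (Set.range fun G : Set (Fin (N + 1) → Fin 2) => (fun x (i : Fin (N + 1)) => g i x) ⁻¹' G)
      (Set.finite_range _) (by
        rintro _ ⟨G, rfl⟩
        exact (measurable_pi_lambda _ fun i : Fin (N + 1) => hgm i) (MeasurableSet.of_discrete))
    have hy' : ∀ G : Set (Fin (N + 1) → Fin 2),
        ε ≤ μ.real (symmDiff (g y ⁻¹' {0}) ((fun x (i : Fin (N + 1)) => g i x) ⁻¹' G)) :=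
      fun G => by rw [hg0]; exact hy _ ⟨G, rfl⟩
    refine ⟨y, ?_, hy'⟩
    -- For `y ≤ N` the set `g y ⁻¹' {0}` itself belongs to the algebra, at distance zero.
    by_contra hyN
    have := hy' {a | a ⟨y, by omega⟩ = 0}
    have he : (fun x (i : Fin (N + 1)) => g i x) ⁻¹' {a | a ⟨y, by omega⟩ = 0} = g y ⁻¹' {0} := by
      ext x; simp
    rw [he, symmDiff_self] at this
    simp only [Set.bot_eq_empty, measureReal_empty] at this
    linarith
  choose next hlt hfar using hnext
  let prev : ℕ → ℕ := fun n => next^[n] 0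
  have hprev : StrictMono prev := strictMono_nat_of_lt_succ fun n => by
    simp only [prev, Function.iterate_succ_apply']
    exact hlt _
  -- The shift drops `prev 0 = 0`, which was not chosen far from anything; now even the first term
  -- contributes `ε`.
  let φ : ℕ → ℕ := fun n => prev (n + 1)
  have hφ : StrictMono φ := fun a b hab => hprev (by omega)
  have hstep : ∀ n : ℕ, labelEntropy μ (fun x (i : Fin n) => g (φ i) x) + ε ≤
      labelEntropy μ (fun x (i : Fin (n + 1)) => g (φ i) x) := by
    intro n
    rw [labelEntropy_fin_succ fun i => g (φ i)]
    obtain ⟨M, hM⟩ := exists_labelEntropy_add_le (μ := μ) (fun x (i : Fin n) => g (φ i) x)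
      (hgm (φ n))
    have hle : ∀ i : Fin n, φ i < prev n + 1 := fun i =>
      Nat.lt_succ_of_le (hprev.monotone i.2)
    -- A set determined by the labels `φ 0, …, φ (n - 1)` is in particular determined by all labels
    -- up to `prev n`.
    have hfarn := hfar (prev n) {a | (fun i : Fin n => a ⟨φ i, hle i⟩) ∈ M}
    have hy : next (prev n) = φ n := by simp only [φ, prev, Function.iterate_succ_apply']
    rw [hy] at hfarn
    exact (add_le_add_right hfarn _).trans hM
  have hall : ∀ n : ℕ, n * ε ≤ labelEntropy μ (fun x (i : Fin n) => g (φ i) x) := by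
    intro n
    induction n with
    | zero => simpa using labelEntropy_nonneg (μ := μ) (fun x (i : Fin 0) => g (φ i) x)
    | succ n ih =>
      push_cast
      linarith [hstep n]
  have h1 : (ε : EReal) ≤ seqEntropyPartition μ hT.measurable (A ∘ φ)
      (MeasPartition.ofLabel hfm) :=
    le_seqEntropyPartition _ _ _ (f := f) (fun _ => rfl) hall
  have h2 := (seqEntropy_eq_zero_iff μ hT.measurable _).1 (h φ hφ) 2 (MeasPartition.ofLabel hfm)
  have h3 : ε ≤ 0 := by exact_mod_cast h1.trans h2
  linarith

end Equivalence

end SeqEntropy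

theorem theorem3p3 (𝕜 : Type*) [RCLike 𝕜] {X : Type*} [MeasurableSpace X]
    (μ : Measure X) [IsProbabilityMeasure μ] [IsSeparable μ]
    (T : X → X) (hT : MeasurePreserving T μ μ) :
    (SeqEntropy.IsRigid 𝕜 hT ↔
      ∃ A : ℕ → ℕ, StrictMono A ∧ SeqEntropy.ZeroEntropyAlong hT A) ∧
    (SeqEntropy.IsRigid 𝕜 hT ↔
      ∃ A : ℕ → ℕ, StrictMono A ∧ SeqEntropy.PrecompactAlong 𝕜 hT A) ∧
    (∀ A : ℕ → ℕ, StrictMono A →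
      (SeqEntropy.ZeroEntropyAlong hT A ↔ SeqEntropy.PrecompactAlong 𝕜 hT A)) := by
  have hrigid : SeqEntropy.IsRigid 𝕜 hT ↔
      ∃ A : ℕ → ℕ, StrictMono A ∧ SeqEntropy.PrecompactAlong 𝕜 hT A :=
    ⟨fun h => h.exists_precompactAlong, fun ⟨_, hA, h⟩ => h.isRigid hA⟩
  have hentropy : ∀ A : ℕ → ℕ,
      (SeqEntropy.ZeroEntropyAlong hT A ↔ SeqEntropy.PrecompactAlong 𝕜 hT A) :=
    fun A => ⟨fun h => h.precompactAlong, fun h => h.zeroEntropyAlong⟩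
  exact ⟨by simp_rw [hentropy]; exact hrigid, hrigid, fun A _ => hentropy A⟩
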